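/- For $F\in\mathrm{GL}^+(3)=\{F\in\mathbb{R}^{3\times 3}:\det F>0\}$ let $U=\sqrt{F^TF}$ be the right stretch tensor, $\operatorname{dev}_3X=X-\tfrac13\operatorname{tr}(X)\,\mathbb 1$ the deviatoric part, and $\|\cdot\|$ the Frobenius norm. For $k>0$ put $W_k(F)=e^{k\|\operatorname{dev}_3\log U\|^2}$ and, on $\mathbb{R}_+^3=(0,\infty)^3$, $$g_k(\lambda_1,\lambda_2,\lambda_3)=\exp\Bigl(\tfrac{k}{3}\Bigl[\log^2\tfrac{\lambda_1}{\lambda_2}+\log^2\tfrac{\lambda_2}{\lambda_3}+\log^2\tfrac{\lambda_3}{\lambda_1}\Bigr]\Bigr).$$ A function $W$ on $\mathrm{GL}^+(3)$ is called rank-one convex if $W(F+(1-\theta)\,\xi\otimes\eta)\le\theta\,W(F)+(1-\theta)\,W(F+\xi\otimes\eta)$ for all $\theta\in[0,1]$, all $F\in\mathrm{GL}^+(3)$ and all $\xi,\eta\in\mathbb{R}^3$ with $F+t\,\xi\otimes\eta\in\mathrm{GL}^+(3)$ for every $t\in[0,1]$. Then for every $k>0$: 1. The function $F\mapsto W_k(F)=e^{k\|\operatorname{dev}_3\log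 U\|^2}$, $F\in\mathrm{GL}^+(3)$, is not rank-one convex. 2. If $F\in\mathrm{GL}^+(3)$ has principal stretches (eigenvalues of $U$, with multiplicity, in any order) $\lambda_1,\lambda_2,\lambda_3$, then these are positive and $W_k(F)=g_k(\lambda_1,\lambda_2,\lambda_3)$. 3. If $k<\tfrac{3}{16}$, then $g_k$ is not separately convex, i.e. it is not true that $g_k$ is convex on $(0,\infty)$ in each variable with the other two fixed. If $k\le\tfrac{3}{16}$, then the strict inequalities $\partial^2g_k/\partial\lambda_i^2>0$, $i=1,2,3$, do not all hold everywhere on $\mathbb{R}_+^3$. 4. If $k\ge\tfrac{3}{16}$, then at the principal stretches $(\lambda_1,\lambda_2,\lambda_3)=(e^{11},e^7,e^{-1})$ one has $\partial^2g_k/\partial\lambda_1^2\ge0$ and $\partial^2g_k/\partial\lambda_2^2\ge0$, but the corresponding Knowles–Sternberg inequality (non-negativity of the following expression) fails: $$\sqrt{\frac{\partial^2g_k}{\partial\lambda_1^2}\,\frac{\partial^2g_k}{\partial\lambda_2^2}}-\frac{\partial^2g_k}{\partial\lambda_1\,\partial\lambda_2}+\frac{\frac{\partial g_k}{\partial\lambda_1}+\frac{\partial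 g_k}{\partial\lambda_2}}{\lambda_1+\lambda_2}<0 .$$ -/

import Mathlib

open scoped Matrix

noncomputable section

namespace HenckyEnergy

/-- The right stretch tensor `U = √(Fᵀ F)` (functional calculus of the symmetric matrix `Fᵀ F`). -/
def rightStretch (F : Matrix (Fin 3) (Fin 3) ℝ) : Matrix (Fin 3) (Fin 3) ℝ :=
  cfc Real.sqrt (Fᵀ * F)

/-- The logarithmic strain tensor `log U` (functional calculus of the symmetric matrix `U`). -/
def logStrain (F : Matrix (Fin 3) (Fin 3) ℝ) : Matrix (Fin 3) (Fin 3) ℝ :=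
  cfc Real.log (rightStretch F)

/-- The deviatoric part `dev₃ X = X - (1/3) tr(X) 1`. -/
def dev (X : Matrix (Fin 3) (Fin 3) ℝ) : Matrix (Fin 3) (Fin 3) ℝ :=
  X - ((1 / 3 : ℝ) * X.trace) • (1 : Matrix (Fin 3) (Fin 3) ℝ)

/-- The squared Frobenius norm `‖X‖² = tr(X Xᵀ)`. -/
def frobeniusSq (X : Matrix (Fin 3) (Fin 3) ℝ) : ℝ := (X * Xᵀ).trace

/-- The isochoric exponentiated Hencky energy `F ↦ exp(k ‖dev₃ log U‖²)`; only its values on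
`GL⁺(3) = {F | 0 < det F}` matter. -/
def energy (k : ℝ) (F : Matrix (Fin 3) (Fin 3) ℝ) : ℝ :=
  Real.exp (k * frobeniusSq (dev (logStrain F)))

/-- Rank-one convexity on `GL⁺(3)`: convexity along all closed segments in `GL⁺(3)` whose end
points differ by a dyad `ξ ⊗ η`. -/
def RankOneConvex (W : Matrix (Fin 3) (Fin 3) ℝ → ℝ) : Prop :=
  ∀ (F : Matrix (Fin 3) (Fin 3) ℝ) (ξ η : Fin 3 → ℝ),
    (∀ t ∈ Set.Icc (0 : ℝ) 1, 0 < (F + t • Matrix.vecMulVec ξ η).det) →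
    ∀ θ ∈ Set.Icc (0 : ℝ) 1,
      W (F + (1 - θ) • Matrix.vecMulVec ξ η) ≤
        θ * W F + (1 - θ) * W (F + Matrix.vecMulVec ξ η)

/-- `l 0, l 1, l 2` are the principal stretches (singular values) of `F`, i.e. the eigenvalues of
`U`, in some order and counted with multiplicity. -/
def IsPrincipalStretches (F : Matrix (Fin 3) (Fin 3) ℝ) (l : Fin 3 → ℝ) : Prop :=
  (rightStretch F).charpoly = ∏ i, (Polynomial.X - Polynomial.C (l i))

/-- The function `g : ℝ₊³ → ℝ` that represents the energy in terms of the principal stretches. -/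
def stretchEnergy (k : ℝ) (l : Fin 3 → ℝ) : ℝ :=
  Real.exp (k / 3 * (Real.log (l 0 / l 1) ^ 2 + Real.log (l 1 / l 2) ^ 2
    + Real.log (l 2 / l 0) ^ 2))

/-- The partial derivative `∂g/∂λᵢ`. -/
def partialDeriv (i : Fin 3) (g : (Fin 3 → ℝ) → ℝ) (l : Fin 3 → ℝ) : ℝ :=
  lineDeriv ℝ g l (Pi.single i 1)

/-- Convexity on `(0, ∞)` in each variable separately, the other variables being fixed. -/
def SeparatelyConvex (g : (Fin 3 → ℝ) → ℝ) : Prop :=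
  ∀ l : Fin 3 → ℝ, (∀ i, 0 < l i) → ∀ i,
    ConvexOn ℝ (Set.Ioi 0) (fun t : ℝ => g (Function.update l i t))

/-- Separate convexity in the strict differential form `∂²g/∂λᵢ² > 0` on `ℝ₊³`
(tension-extension inequalities). -/
def StrictSC (g : (Fin 3 → ℝ) → ℝ) : Prop :=
  ∀ l : Fin 3 → ℝ, (∀ i, 0 < l i) → ∀ i, 0 < partialDeriv i (partialDeriv i g) l

/-- The left side of the Knowles-Sternberg inequality
`√(g_ii g_jj) - g_ij + (g_i + g_j) / (λᵢ + λⱼ) ≥ 0`. -/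
def knowlesSternberg (g : (Fin 3 → ℝ) → ℝ) (i j : Fin 3) (l : Fin 3 → ℝ) : ℝ :=
  Real.sqrt (partialDeriv i (partialDeriv i g) l * partialDeriv j (partialDeriv j g) l)
    - partialDeriv i (partialDeriv j g) l
    + (partialDeriv i g l + partialDeriv j g l) / (l i + l j)

end HenckyEnergy

end

namespace HenckyEnergy

open Polynomial in
theorem map_univ_eq_of_prod_X_sub_C_eq {ι R : Type*} [Fintype ι] [CommRing R] [IsDomain R]
    {u v : ι → R} (h : ∏ i, (X - C (u i)) = ∏ i, (X - C (v i))) :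
    Finset.univ.val.map u = Finset.univ.val.map v := by
  have key : ∀ w : ι → R, (∏ i, (X - C (w i))).roots = Finset.univ.val.map w := fun w => by
    have := roots_multiset_prod_X_sub_C (Finset.univ.val.map w)
    rwa [Multiset.map_map] at this
  rw [← key u, ← key v, h]

open Polynomial in
theorem charpoly_cfc_of_charpoly_eq {n : Type*} [Fintype n] [DecidableEq n] {A : Matrix n n ℝ}
    (hA : A.IsHermitian) {l : n → ℝ} (hl : A.charpoly = ∏ i, (X - C (l i))) (f : ℝ → ℝ) :
    (cfc f A).charpoly = ∏ i, (X - C (f (l i))) := by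
  have h : Finset.univ.val.map hA.eigenvalues = Finset.univ.val.map l :=
    map_univ_eq_of_prod_X_sub_C_eq (by rw [← hl, hA.charpoly_eq]; rfl)
  rw [hA.charpoly_cfc_eq]
  have := congrArg (fun s : Multiset ℝ => (s.map (fun x => X - C (f x))).prod) h
  simp only [Multiset.map_map] at this
  exact this

open Polynomial in
theorem trace_eq_sum_of_charpoly_eq {n : Type*} [Fintype n] [DecidableEq n] {A : Matrix n n ℝ}
    {l : n → ℝ} (hl : A.charpoly = ∏ i, (X - C (l i))) : A.trace = ∑ i, l i := by
  have hr : A.charpoly.roots = Finset.univ.val.map l := by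
    have := roots_multiset_prod_X_sub_C (Finset.univ.val.map l)
    rw [Multiset.map_map] at this
    rw [hl]; exact this
  rw [Matrix.trace_eq_sum_roots_charpoly_of_splits, hr, Finset.sum]
  rw [splits_iff_card_roots, hr]
  simp

theorem isHermitian_cfc {n : Type*} [Fintype n] [DecidableEq n] (A : Matrix n n ℝ)
    (f : ℝ → ℝ) : (cfc f A).IsHermitian :=
  IsSelfAdjoint.cfc (f := f) (a := A)

theorem isHermitian_transpose_mul (F : Matrix (Fin 3) (Fin 3) ℝ) : (Fᵀ * F).IsHermitian := by
  simpa only [Matrix.conjTranspose_eq_transpose_of_trivial] using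
    Matrix.isHermitian_conjTranspose_mul_self F

theorem frobeniusSq_dev {X : Matrix (Fin 3) (Fin 3) ℝ} (hX : X.IsHermitian) :
    frobeniusSq (dev X) = (X * X).trace - 1 / 3 * X.trace ^ 2 := by
  have hT : Xᵀ = X := by
    simpa only [Matrix.conjTranspose_eq_transpose_of_trivial] using hX.eq
  simp only [frobeniusSq, dev, Matrix.transpose_sub, Matrix.transpose_smul, Matrix.transpose_one,
    hT, mul_sub, sub_mul, Matrix.trace_sub, smul_mul_assoc, mul_smul_comm, one_mul, mul_one,
    Matrix.trace_smul, Matrix.trace_one, Fintype.card_fin, smul_eq_mul]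
  push_cast
  ring

theorem IsPrincipalStretches.pos {F : Matrix (Fin 3) (Fin 3) ℝ} {l : Fin 3 → ℝ}
    (hF : 0 < F.det) (hl : IsPrincipalStretches F l) (i : Fin 3) : 0 < l i := by
  have hA := isHermitian_transpose_mul F
  have hpd : (Fᵀ * F).PosDef := by
    have := Matrix.PosDef.conjTranspose_mul_self F
      (Matrix.mulVec_injective_iff_isUnit.2 ((Matrix.isUnit_iff_isUnit_det F).2 hF.ne'.isUnit))
    simpa only [Matrix.conjTranspose_eq_transpose_of_trivial] using this
  have h : Finset.univ.val.map l
      = Finset.univ.val.map (fun i => Real.sqrt (hA.eigenvalues i)) := by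
    refine map_univ_eq_of_prod_X_sub_C_eq ?_
    rw [← hl, rightStretch, hA.charpoly_cfc_eq]; rfl
  have hi : l i ∈ Finset.univ.val.map l := Multiset.mem_map_of_mem l (Finset.mem_univ i)
  rw [h, Multiset.mem_map] at hi
  obtain ⟨j, -, hj⟩ := hi
  rw [← hj]
  exact Real.sqrt_pos.2 (hpd.eigenvalues_pos j)

theorem energy_eq_stretchEnergy {k : ℝ} {F : Matrix (Fin 3) (Fin 3) ℝ} {l : Fin 3 → ℝ}
    (hF : 0 < F.det) (hl : IsPrincipalStretches F l) : energy k F = stretchEnergy k l := by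
  have hpos := hl.pos hF
  have hU : (rightStretch F).IsHermitian := isHermitian_cfc _ _
  have hc : ∀ f : ℝ → ℝ, ContinuousOn f (spectrum ℝ (rightStretch F)) := fun f =>
    (Matrix.finite_real_spectrum (A := rightStretch F)).continuousOn f
  have h1 : (logStrain F).trace = ∑ i, Real.log (l i) :=
    trace_eq_sum_of_charpoly_eq (charpoly_cfc_of_charpoly_eq hU hl _)
  have h2 : (logStrain F * logStrain F).trace = ∑ i, Real.log (l i) * Real.log (l i) := by
    rw [logStrain, ← cfc_mul _ _ _ (hc _) (hc _)]
    exact trace_eq_sum_of_charpoly_eq (charpoly_cfc_of_charpoly_eq hU hl _)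
  rw [energy, stretchEnergy, frobeniusSq_dev (X := logStrain F) (isHermitian_cfc _ _), h1, h2,
    Real.log_div (hpos 0).ne' (hpos 1).ne', Real.log_div (hpos 1).ne' (hpos 2).ne',
    Real.log_div (hpos 2).ne' (hpos 0).ne', Fin.sum_univ_three, Fin.sum_univ_three]
  congr 1
  ring

theorem isPrincipalStretches_of_charpoly {F : Matrix (Fin 3) (Fin 3) ℝ} {l : Fin 3 → ℝ}
    (hl : ∀ i, 0 ≤ l i)
    (h : (Fᵀ * F).charpoly = ∏ i, (Polynomial.X - Polynomial.C (l i ^ 2))) :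
    IsPrincipalStretches F l := by
  have := charpoly_cfc_of_charpoly_eq (isHermitian_transpose_mul F) h Real.sqrt
  simp only [Real.sqrt_sq (hl _)] at this
  exact this

open Polynomial in
theorem isPrincipalStretches_shear {s b m a c : ℝ} (ha : 0 ≤ a) (hc : 0 ≤ c) (hm : 0 ≤ m)
    (hac : a * c = s) (hsum : a ^ 2 + c ^ 2 = s ^ 2 + b ^ 2 + 1) :
    IsPrincipalStretches !![s, b, 0; 0, 1, 0; 0, 0, m] ![a, c, m] := by
  refine isPrincipalStretches_of_charpoly (by simp [Fin.forall_fin_succ, ha, hc, hm]) ?_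
  have h1 : (C a * C c : ℝ[X]) = C s := by rw [← C_mul, hac]
  have h2 : (C a ^ 2 + C c ^ 2 : ℝ[X]) = C s ^ 2 + C b ^ 2 + 1 := by
    simpa using congrArg C hsum
  have h : (!![s, b, 0; 0, 1, 0; 0, 0, m]ᵀ * !![s, b, 0; 0, 1, 0; 0, 0, m])
      = !![s ^ 2, s * b, 0; s * b, b ^ 2 + 1, 0; 0, 0, m ^ 2] := by
    ext i j
    fin_cases i <;> fin_cases j <;> simp [Matrix.mul_apply, Fin.sum_univ_three] <;> ring
  rw [h, Matrix.charpoly, Matrix.det_fin_three]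
  simp [Fin.prod_univ_three]
  linear_combination (X - C m ^ 2) * (X * h2 - (C a * C c + C s) * h1)

theorem stretchEnergy_eq_exp (k : ℝ) {l : Fin 3 → ℝ} (hl : ∀ i, 0 < l i) :
    stretchEnergy k l = Real.exp (k / 3 * ((Real.log (l 0) - Real.log (l 1)) ^ 2
      + (Real.log (l 1) - Real.log (l 2)) ^ 2 + (Real.log (l 2) - Real.log (l 0)) ^ 2)) := by
  rw [stretchEnergy, Real.log_div (hl 0).ne' (hl 1).ne', Real.log_div (hl 1).ne' (hl 2).ne',
    Real.log_div (hl 2).ne' (hl 0).ne']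

theorem energy_shear (k : ℝ) {s b m a c : ℝ} (ha : 0 < a) (hc : 0 < c) (hm : 0 < m)
    (hac : a * c = s) (hsum : a ^ 2 + c ^ 2 = s ^ 2 + b ^ 2 + 1) :
    energy k !![s, b, 0; 0, 1, 0; 0, 0, m]
      = Real.exp (k / 3 * ((Real.log a - Real.log c) ^ 2
        + (Real.log c - Real.log m) ^ 2 + (Real.log m - Real.log a) ^ 2)) := by
  have hdet : 0 < (!![s, b, 0; 0, 1, 0; 0, 0, m] : Matrix (Fin 3) (Fin 3) ℝ).det := by
    simp [Matrix.det_fin_three, ← hac]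
    positivity
  rw [energy_eq_stretchEnergy hdet (isPrincipalStretches_shear ha.le hc.le hm.le hac hsum),
    stretchEnergy_eq_exp k (by simp [Fin.forall_fin_succ, ha, hc, hm])]
  simp

/-- Along the segment from `diag(1, 1, 2²⁴)` in the direction `e₁ ⊗ (1, h, 0)` the energy has a
larger value at an interior point than at both end points, for every `k > 0`. -/
theorem not_rankOneConvex_energy {k : ℝ} (hk : 0 < k) : ¬ RankOneConvex (energy k) := by
  intro hW
  obtain ⟨h, hh⟩ : ∃ h : ℝ, h ^ 2 = 7161 / 64 := ⟨√(7161 / 64), Real.sq_sqrt (by norm_num)⟩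
  obtain ⟨y, hy0, hy⟩ : ∃ y : ℝ, 1 ≤ y ∧ y ^ 2 = 1275 / 32 * y + 1 := by
    have hs := Real.sq_sqrt (show (0 : ℝ) ≤ (1275 / 32) ^ 2 + 4 by norm_num)
    have hs0 := Real.sqrt_nonneg ((1275 / 32 : ℝ) ^ 2 + 4)
    refine ⟨(1275 / 32 + √((1275 / 32) ^ 2 + 4)) / 2, by linarith, by linarith⟩
  have hseg : ∀ t : ℝ, (!![1, 0, 0; 0, 1, 0; 0, 0, 2 ^ 24] : Matrix (Fin 3) (Fin 3) ℝ)
      + t • Matrix.vecMulVec ![1, 0, 0] ![15, 15 * h, 0]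
      = !![1 + 15 * t, 15 * h * t, 0; 0, 1, 0; 0, 0, 2 ^ 24] := by
    intro t
    ext i j
    fin_cases i <;> fin_cases j <;> simp <;> ring
  have hineq := hW !![1, 0, 0; 0, 1, 0; 0, 0, 2 ^ 24] ![1, 0, 0] ![15, 15 * h, 0] (by
    rintro t ⟨ht, -⟩
    rw [hseg]
    simp [Matrix.det_fin_three]
    positivity) (4 / 5) ⟨by norm_num, by norm_num⟩
  have hend := hseg 1
  rw [one_smul] at hend
  have hlog2 : 0 < Real.log 2 := Real.log_pos (by norm_num)
  have hm : Real.log (2 ^ 24) = 24 * Real.log 2 := by simp [Real.log_pow]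
  rw [hseg, hend,
    energy_shear k (s := 1) (b := 0) (a := 1) (c := 1) (by norm_num) (by norm_num) (by norm_num)
      (by norm_num) (by norm_num),
    energy_shear k (a := 2 ^ 5) (c := (2 ^ 3)⁻¹) (by norm_num) (by norm_num) (by norm_num)
      (by norm_num) (by norm_num; linear_combination -9 * hh),
    energy_shear k (a := 2 ^ 2 * y) (c := 2 ^ 2 * y⁻¹) (by positivity) (by positivity)
      (by norm_num) (by field_simp; norm_num)
      (by
        have : y ≠ 0 := by positivity
        field_simp
        linear_combination (16 * y ^ 2 + 16 * (1275 / 32) * y - 16) * hy - 225 * y ^ 2 * hh),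
    hm, Real.log_mul (by norm_num) (by positivity), Real.log_mul (by norm_num) (by positivity),
    Real.log_inv, Real.log_inv, Real.log_pow, Real.log_pow, Real.log_pow, Real.log_one] at hineq
  push_cast at hineq
  have hy1 : y ^ 2 ≤ 2 ^ 11 := by nlinarith
  have hz0 : 0 ≤ Real.log y := Real.log_nonneg hy0
  have hz : 2 * Real.log y ≤ 11 * Real.log 2 := by
    have := Real.log_le_log (by positivity) hy1
    rwa [Real.log_pow, Real.log_pow] at this
  have hz2 : 4 * Real.log y ^ 2 ≤ 121 * Real.log 2 ^ 2 := by nlinarith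
  have hp : 0 < Real.log 2 ^ 2 := by positivity
  have e1 : Real.exp (k / 3 * ((0 - 0) ^ 2 + (0 - 24 * Real.log 2) ^ 2
      + (24 * Real.log 2 - 0) ^ 2)) < Real.exp (k / 3 * (1154 * Real.log 2 ^ 2)) := by
    refine Real.exp_lt_exp.2 (mul_lt_mul_of_pos_left ?_ (by positivity))
    nlinarith
  have e3 : Real.exp (k / 3 * ((2 * Real.log 2 + Real.log y - (2 * Real.log 2 + -Real.log y)) ^ 2
      + (2 * Real.log 2 + -Real.log y - 24 * Real.log 2) ^ 2
      + (24 * Real.log 2 - (2 * Real.log 2 + Real.log y)) ^ 2))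
      < Real.exp (k / 3 * (1154 * Real.log 2 ^ 2)) := by
    refine Real.exp_lt_exp.2 (mul_lt_mul_of_pos_left ?_ (by positivity))
    nlinarith
  have e2 : Real.exp (k / 3 * ((5 * Real.log 2 - -(3 * Real.log 2)) ^ 2
      + (-(3 * Real.log 2) - 24 * Real.log 2) ^ 2 + (24 * Real.log 2 - 5 * Real.log 2) ^ 2))
      = Real.exp (k / 3 * (1154 * Real.log 2 ^ 2)) := by
    congr 1
    ring
  rw [e2] at hineq
  linarith

/-- `3 log λᵢ - log (λ₁ λ₂ λ₃)`, three times the `i`-th principal value of `dev₃ log U`. -/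
noncomputable def logDev (i : Fin 3) (l : Fin 3 → ℝ) : ℝ := 3 * Real.log (l i) - ∑ m, Real.log (l m)

theorem hasDerivAt_log_line {l : Fin 3 → ℝ} (hl : ∀ m, 0 < l m) (i m : Fin 3) :
    HasDerivAt (fun t : ℝ => Real.log ((l + t • Pi.single i (1 : ℝ) : Fin 3 → ℝ) m))
      (if m = i then (l i)⁻¹ else 0) 0 := by
  by_cases h : m = i
  · subst h
    have h1 : HasDerivAt (fun t : ℝ => l m + t) 1 0 := (hasDerivAt_id 0).const_add _
    have := h1.log (by simpa using (hl m).ne')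
    simpa using this
  · simpa [h] using hasDerivAt_const (0 : ℝ) (Real.log (l m))

theorem eventually_line_pos {l : Fin 3 → ℝ} (hl : ∀ m, 0 < l m) (v : Fin 3 → ℝ) :
    ∀ᶠ t : ℝ in nhds 0, ∀ m, 0 < (l + t • v) m := by
  rw [Filter.eventually_all]
  intro m
  have hc : Continuous fun t : ℝ => (l + t • v) m := by
    simp only [Pi.add_apply, Pi.smul_apply, smul_eq_mul]; fun_prop
  exact continuousAt_const.eventually_lt hc.continuousAt (by simpa using hl m)

theorem hasLineDerivAt_congr_of_pos {g₁ g₂ : (Fin 3 → ℝ) → ℝ}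
    (h : ∀ l : Fin 3 → ℝ, (∀ m, 0 < l m) → g₁ l = g₂ l) {l v : Fin 3 → ℝ} (hl : ∀ m, 0 < l m)
    {d : ℝ} (hd : HasLineDerivAt ℝ g₂ d l v) : HasLineDerivAt ℝ g₁ d l v :=
  HasDerivAt.congr_of_eventuallyEq hd ((eventually_line_pos hl v).mono fun _ ht => h _ ht)

theorem hasDerivAt_logDev_line {l : Fin 3 → ℝ} (hl : ∀ m, 0 < l m) (i j : Fin 3) :
    HasDerivAt (fun t : ℝ => logDev j (l + t • Pi.single i (1 : ℝ)))
      ((if j = i then 2 else -1) / l i) 0 := by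
  have h := ((hasDerivAt_log_line hl i j).const_mul 3).sub
    (HasDerivAt.fun_sum (u := Finset.univ) fun m _ => hasDerivAt_log_line hl i m)
  refine h.congr_deriv ?_
  rw [Finset.sum_ite_eq' Finset.univ i, if_pos (Finset.mem_univ i)]
  split_ifs <;> ring

theorem hasLineDerivAt_stretchEnergy (k : ℝ) {l : Fin 3 → ℝ} (hl : ∀ m, 0 < l m) (i : Fin 3) :
    HasLineDerivAt ℝ (stretchEnergy k) (stretchEnergy k l * (2 * k / 3 * logDev i l) / l i) l
      (Pi.single i 1) := by
  refine hasLineDerivAt_congr_of_pos (fun l hl => stretchEnergy_eq_exp k hl) hl ?_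
  have hx := hasDerivAt_log_line hl i
  have h := ((((((hx 0).sub (hx 1)).pow 2).add (((hx 1).sub (hx 2)).pow 2)).add
    (((hx 2).sub (hx 0)).pow 2)).const_mul (k / 3)).exp
  refine HasDerivAt.congr_deriv h ?_
  rw [stretchEnergy_eq_exp k hl]
  simp only [Pi.add_apply, Pi.sub_apply, Pi.pow_apply, Pi.zero_apply, zero_smul, add_zero, logDev,
    Fin.sum_univ_three, mul_div_assoc]
  congr 1
  fin_cases i <;> simp <;> ring

theorem partialDeriv_stretchEnergy (k : ℝ) {l : Fin 3 → ℝ} (hl : ∀ m, 0 < l m) (i : Fin 3) :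
    partialDeriv i (stretchEnergy k) l
      = stretchEnergy k l * (2 * k / 3 * logDev i l) / l i :=
  (hasLineDerivAt_stretchEnergy k hl i).lineDeriv

theorem partialDeriv_partialDeriv_stretchEnergy (k : ℝ) {l : Fin 3 → ℝ} (hl : ∀ m, 0 < l m)
    (i j : Fin 3) :
    partialDeriv i (partialDeriv j (stretchEnergy k)) l
      = stretchEnergy k l / (l i * l j) * ((2 * k / 3 * logDev i l) * (2 * k / 3 * logDev j l)
        + if j = i then 4 * k / 3 - 2 * k / 3 * logDev i l else -(2 * k / 3)) := by
  refine (hasLineDerivAt_congr_of_pos (fun l hl => partialDeriv_stretchEnergy k hl j) hl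
    (d := _) ?_).lineDeriv
  have hg : HasDerivAt (fun t : ℝ => stretchEnergy k (l + t • Pi.single i (1 : ℝ))) _ 0 :=
    hasLineDerivAt_stretchEnergy k hl i
  have hj : HasDerivAt (fun t : ℝ => (l + t • Pi.single i (1 : ℝ) : Fin 3 → ℝ) j)
      (if j = i then 1 else 0) 0 := by
    by_cases h : j = i
    · subst h
      simpa using (hasDerivAt_id (0 : ℝ)).const_add (l j)
    · simpa [h] using hasDerivAt_const (0 : ℝ) (l j)
  have h := (hg.mul ((hasDerivAt_logDev_line hl i j).const_mul (2 * k / 3))).div hj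
    (by simpa using (hl j).ne')
  refine HasDerivAt.congr_deriv h ?_
  simp only [Pi.mul_apply, zero_smul, add_zero]
  have hi0 := (hl i).ne'
  have hj0 := (hl j).ne'
  by_cases h : j = i
  · subst h
    simp only [if_true]
    field_simp
    ring
  · simp only [h, if_false]
    field_simp
    ring

/-- At `(t, 1, 1)` with `log t = 3 / (8 k)`, the derivative `∂²g/∂λ₁²` has the sign of
`k - 3 / 16`. -/
theorem exists_partialDeriv_partialDeriv_stretchEnergy_eq {k : ℝ} (hk : 0 < k) :
    ∃ l : Fin 3 → ℝ, (∀ m, 0 < l m) ∧ ∃ c > 0,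
      partialDeriv 0 (partialDeriv 0 (stretchEnergy k)) l = c * (k - 3 / 16) := by
  have hl : ∀ m, 0 < (![Real.exp (3 / (8 * k)), 1, 1] : Fin 3 → ℝ) m := by
    simp [Fin.forall_fin_succ, Real.exp_pos]
  refine ⟨_, hl, 4 / 3 * (stretchEnergy k ![Real.exp (3 / (8 * k)), 1, 1]
    / (Real.exp (3 / (8 * k)) * Real.exp (3 / (8 * k)))), ?_, ?_⟩
  · have : 0 < stretchEnergy k ![Real.exp (3 / (8 * k)), 1, 1] := Real.exp_pos _
    positivity
  · rw [partialDeriv_partialDeriv_stretchEnergy k hl]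
    have hs : 2 * k / 3 * logDev 0 ![Real.exp (3 / (8 * k)), 1, 1] = 1 / 2 := by
      simp [logDev, Fin.sum_univ_three]
      field_simp
      norm_num
    rw [hs]
    simp only [if_true, Matrix.cons_val_zero]
    ring

theorem not_strictSC_stretchEnergy {k : ℝ} (hk : 0 < k) (hk' : k ≤ 3 / 16) :
    ¬ StrictSC (stretchEnergy k) := by
  intro h
  obtain ⟨l, hl, c, hc, e⟩ := exists_partialDeriv_partialDeriv_stretchEnergy_eq hk
  have := h l hl 0
  rw [e] at this
  nlinarith

theorem add_smul_single_eq_update (l : Fin 3 → ℝ) (i : Fin 3) (t : ℝ) :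
    l + t • Pi.single i (1 : ℝ) = Function.update l i (l i + t) := by
  ext m
  by_cases h : m = i
  · subst h; simp
  · simp [h]

theorem partialDeriv_eq_deriv (g : (Fin 3 → ℝ) → ℝ) (l : Fin 3 → ℝ) (i : Fin 3) :
    partialDeriv i g l = deriv (fun t => g (Function.update l i t)) (l i) := by
  simp only [partialDeriv, lineDeriv, add_smul_single_eq_update]
  rw [deriv_comp_const_add (fun t => g (Function.update l i t)) (l i) 0, add_zero]

theorem partialDeriv_partialDeriv_nonneg_of_separatelyConvex {k : ℝ}
    (h : SeparatelyConvex (stretchEnergy k)) {l : Fin 3 → ℝ} (hl : ∀ m, 0 < l m) (i : Fin 3) :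
    0 ≤ partialDeriv i (partialDeriv i (stretchEnergy k)) l := by
  have hpos : ∀ t : ℝ, 0 < t → ∀ m, 0 < Function.update l i t m := fun t ht m => by
    by_cases hm : m = i
    · subst hm; simpa using ht
    · simpa [hm] using hl m
  have hdiff : ∀ t ∈ Set.Ioi (0 : ℝ),
      DifferentiableAt ℝ (fun t => stretchEnergy k (Function.update l i t)) t := by
    intro t ht
    have h1 : HasDerivAt (fun r : ℝ => stretchEnergy k (Function.update l i t
      + r • Pi.single i (1 : ℝ))) _ 0 := hasLineDerivAt_stretchEnergy k (hpos t ht) i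
    simp only [add_smul_single_eq_update, Function.update_idem, Function.update_self] at h1
    rw [← sub_self t] at h1
    simpa using (h1.comp_sub_const t t).differentiableAt
  have hmono := (h l hl i).monotoneOn_deriv hdiff
  have heq : (fun t => partialDeriv i (stretchEnergy k) (Function.update l i t))
      = deriv fun t => stretchEnergy k (Function.update l i t) := by
    ext t
    rw [partialDeriv_eq_deriv]
    simp
  rw [partialDeriv_eq_deriv, heq, ← derivWithin_of_isOpen isOpen_Ioi (hl i)]
  exact hmono.derivWithin_nonneg

theorem not_separatelyConvex_stretchEnergy {k : ℝ} (hk : 0 < k) (hk' : k < 3 / 16) :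
    ¬ SeparatelyConvex (stretchEnergy k) := by
  intro h
  obtain ⟨l, hl, c, hc, e⟩ := exists_partialDeriv_partialDeriv_stretchEnergy_eq hk
  have := partialDeriv_partialDeriv_nonneg_of_separatelyConvex h hl 0
  rw [e] at this
  nlinarith

theorem knowlesSternberg_stretchEnergy_neg {k : ℝ} (hk : 3 / 16 ≤ k) :
    0 ≤ partialDeriv 0 (partialDeriv 0 (stretchEnergy k))
        ![Real.exp 11, Real.exp 7, Real.exp (-1)] ∧
    0 ≤ partialDeriv 1 (partialDeriv 1 (stretchEnergy k))
        ![Real.exp 11, Real.exp 7, Real.exp (-1)] ∧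
    knowlesSternberg (stretchEnergy k) 0 1 ![Real.exp 11, Real.exp 7, Real.exp (-1)] < 0 := by
  have hl : ∀ m, 0 < (![Real.exp 11, Real.exp 7, Real.exp (-1)] : Fin 3 → ℝ) m := by
    simp [Fin.forall_fin_succ, Real.exp_pos]
  have hd0 : logDev 0 ![Real.exp 11, Real.exp 7, Real.exp (-1)] = 16 := by
    simp [logDev, Fin.sum_univ_three]; norm_num
  have hd1 : logDev 1 ![Real.exp 11, Real.exp 7, Real.exp (-1)] = 4 := by
    simp [logDev, Fin.sum_univ_three]; norm_num
  have hG : 0 < stretchEnergy k ![Real.exp 11, Real.exp 7, Real.exp (-1)] := Real.exp_pos _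
  have h11 : Real.exp 11 = Real.exp 4 * Real.exp 7 := by rw [← Real.exp_add]; norm_num
  have he4 : 15 < Real.exp 4 := by
    have h1 : (2 : ℝ) < Real.exp 1 := Real.exp_one_gt_two
    have h2 : Real.exp 4 = Real.exp 1 ^ 4 := by rw [← Real.exp_nat_mul]; norm_num
    rw [h2]
    calc (15 : ℝ) < 2 ^ 4 := by norm_num
      _ ≤ _ := by gcongr
  rw [knowlesSternberg]
  simp only [partialDeriv_partialDeriv_stretchEnergy k hl, partialDeriv_stretchEnergy k hl,
    hd0, hd1, if_true, if_neg (show ¬ (1 : Fin 3) = 0 by decide), Matrix.cons_val_zero,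
    Matrix.cons_val_one]
  generalize stretchEnergy k ![Real.exp 11, Real.exp 7, Real.exp (-1)] = G at hG ⊢
  rw [h11]
  have hb : 0 < Real.exp 7 := Real.exp_pos 7
  generalize Real.exp 7 = b at hb ⊢
  generalize Real.exp 4 = r at he4 ⊢
  have hr : 0 < r := by linarith
  obtain ⟨c, hc, rfl⟩ : ∃ c : ℝ, 1 / 8 ≤ c ∧ k = 3 / 2 * c :=
    ⟨2 / 3 * k, by linarith, by ring⟩
  have hc0 : 0 < c := by linarith
  have p0 : 0 ≤ c * (256 * c - 14) := mul_nonneg hc0.le (by linarith)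
  have p1 : 0 ≤ c * (16 * c - 2) := mul_nonneg hc0.le (by linarith)
  have q0 : G / (r * b * (r * b)) * (2 * (3 / 2 * c) / 3 * 16 * (2 * (3 / 2 * c) / 3 * 16)
      + (4 * (3 / 2 * c) / 3 - 2 * (3 / 2 * c) / 3 * 16))
      = G / (r * b * (r * b)) * (c * (256 * c - 14)) := by ring
  have q1 : G / (b * b) * (2 * (3 / 2 * c) / 3 * 4 * (2 * (3 / 2 * c) / 3 * 4)
      + (4 * (3 / 2 * c) / 3 - 2 * (3 / 2 * c) / 3 * 4))
      = G / (b * b) * (c * (16 * c - 2)) := by ring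
  rw [q0, q1]
  refine ⟨by positivity, by positivity, ?_⟩
  have hsqrt : √(G / (r * b * (r * b)) * (c * (256 * c - 14)) * (G / (b * b) * (c * (16 * c - 2))))
      ≤ G * c / (r * b * b) * (64 * c - 23 / 4) := by
    rw [Real.sqrt_le_left (mul_nonneg (by positivity) (by linarith))]
    have e : G / (r * b * (r * b)) * (c * (256 * c - 14)) * (G / (b * b) * (c * (16 * c - 2)))
        = (G * c / (r * b * b)) ^ 2 * ((256 * c - 14) * (16 * c - 2)) := by
      field_simp
    rw [e, mul_pow]
    gcongr
    nlinarith
  have e : G * c / (r * b * b) * (64 * c - 23 / 4)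
      - G / (r * b * b) * (2 * (3 / 2 * c) / 3 * 16 * (2 * (3 / 2 * c) / 3 * 4)
        + -(2 * (3 / 2 * c) / 3))
      + (G * (2 * (3 / 2 * c) / 3 * 16) / (r * b) + G * (2 * (3 / 2 * c) / 3 * 4) / b) / (r * b + b)
      = G * c / (r * b * b) * ((45 - 3 * r) / (4 * (r + 1))) := by
    have : r + 1 ≠ 0 := by positivity
    have h2 : r * b + b = (r + 1) * b := by ring
    rw [h2]
    field_simp
    ring
  have hneg : G * c / (r * b * b) * ((45 - 3 * r) / (4 * (r + 1))) < 0 :=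
    mul_neg_of_pos_of_neg (by positivity) (div_neg_of_neg_of_pos (by linarith) (by positivity))
  linarith

end HenckyEnergy

theorem mainTheorem3 (k : ℝ) (hk : 0 < k) :
    ¬ HenckyEnergy.RankOneConvex (HenckyEnergy.energy k) ∧
    (∀ (F : Matrix (Fin 3) (Fin 3) ℝ) (l : Fin 3 → ℝ), 0 < F.det →
      HenckyEnergy.IsPrincipalStretches F l →
        (∀ i, 0 < l i) ∧ HenckyEnergy.energy k F = HenckyEnergy.stretchEnergy k l) ∧
    (k < 3 / 16 → ¬ HenckyEnergy.SeparatelyConvex (HenckyEnergy.stretchEnergy k)) ∧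
    (k ≤ 3 / 16 → ¬ HenckyEnergy.StrictSC (HenckyEnergy.stretchEnergy k)) ∧
    (3 / 16 ≤ k →
      0 ≤ HenckyEnergy.partialDeriv 0
          (HenckyEnergy.partialDeriv 0 (HenckyEnergy.stretchEnergy k))
          ![Real.exp 11, Real.exp 7, Real.exp (-1)] ∧
      0 ≤ HenckyEnergy.partialDeriv 1
          (HenckyEnergy.partialDeriv 1 (HenckyEnergy.stretchEnergy k))
          ![Real.exp 11, Real.exp 7, Real.exp (-1)] ∧
      HenckyEnergy.knowlesSternberg (HenckyEnergy.stretchEnergy k) 0 1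
          ![Real.exp 11, Real.exp 7, Real.exp (-1)] < 0) := by
  exact ⟨HenckyEnergy.not_rankOneConvex_energy hk,
    fun _ _ hF hl => ⟨hl.pos hF, HenckyEnergy.energy_eq_stretchEnergy hF hl⟩,
    HenckyEnergy.not_separatelyConvex_stretchEnergy hk,
    HenckyEnergy.not_strictSC_stretchEnergy hk, HenckyEnergy.knowlesSternberg_stretchEnergy_neg⟩
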